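/- Let $\mathcal M$ be a regular matroid (i.e. representable over every field) on a finite ground set $E$, and let $M$ be a totally unimodular real matrix, with columns indexed by $E$, that represents $\mathcal M$ (a subset of $E$ is independent in $\mathcal M$ if and only if the corresponding columns of $M$ are linearly independent). Let $\operatorname{Row}(M)\subseteq\mathbb R^E$ be the real row space of $M$, and let $\Gamma(\mathcal M)=\operatorname{Row}(M)\cap\mathbb Z^E$ be the lattice of integer cuts. Let $$V_0=\{x\in\operatorname{Row}(M) : \|x\|\le\|x-\mu\|\ \text{ for all }\mu\in\Gamma(\mathcal M)\}$$ be its Voronoi cell at the origin (with respect to the Euclidean norm), and let $\mathcal{FP}^c(\mathcal M)$ be the poset of nonempty faces of $V_0$ (including $V_0$ itself), ordered by inclusion. Let $\mathcal{CAC}(\mathcal M)$ be the following poset. Its elements are the pairs $(\mathcal N,D)$, where $\mathcal N$ is a submatroid of $\mathcal M$ (a subset $E(\mathcal N)\subseteq E$ with the induced independent sets) and $D:E(\mathcal N)\to\{1,-1\}$ is a coherent acyclic orientation of $\mathcal N$, which means: for every $e\in E(\mathcal N)$ there is $z_e\in(\mathbb Z_{\ge0})^{E(\mathcal N)}$, extended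 by zero to $E$, such that $e+z_e\in\operatorname{Row}(M^D)\cap\mathbb Z^E$, where $e$ also denotes the standard basis vector of $\mathbb R^E$ indexed by $e$, and $M^D$ is obtained from $M$ by multiplying, for each $f\in E(\mathcal N)$, the column indexed by $f$ by $D(f)$. The order is given by $(\mathcal N,D)\le(\mathcal N',D')$ if and only if $\mathcal N'$ is a submatroid of $\mathcal N$ and $D'$ is the restriction of $D$ to $E(\mathcal N')$. **Theorem.** The posets $\mathcal{FP}^c(\mathcal M)$ and $\mathcal{CAC}(\mathcal M)$ are isomorphic. -/

import Mathlib

open scoped Matroid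

noncomputable section

namespace RegularMatroid

/-- The matrix `A`, with columns indexed by `E`, represents the matroid `𝓜` on `E`: a set is
independent in `𝓜` iff the corresponding family of columns of `A` is linearly independent. -/
def Represents {F ρ E : Type*} [Field F] (A : Matrix ρ E F) (𝓜 : Matroid E) : Prop :=
  𝓜.E = Set.univ ∧ ∀ I : Set E, 𝓜.Indep I ↔ LinearIndepOn F A.col I

/-- A matroid is regular if it is representable over every field. -/
def IsRegular {E : Type*} (𝓜 : Matroid E) : Prop :=
  ∀ (F : Type) [Field F], ∃ (r : ℕ) (A : Matrix (Fin r) E F), Represents A 𝓜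

section Lattice

variable {E ρ : Type*} [Fintype E]

/-- The cut space `Row(M)`: the real row space of `M`, inside Euclidean space `ℝ^E`. -/
def cutSpace (M : Matrix ρ E ℝ) : Submodule ℝ (EuclideanSpace ℝ E) :=
  Submodule.span ℝ (Set.range fun i : ρ => WithLp.toLp 2 (M.row i))

/-- The integer points `ℤ^E` of `ℝ^E`. -/
def integerPoints (E : Type*) [Fintype E] : AddSubgroup (EuclideanSpace ℝ E) where
  carrier := {x | ∀ e, ∃ k : ℤ, x e = k}
  zero_mem' := fun _ => ⟨0, by simp⟩
  add_mem' := by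
    intro x y hx hy e
    obtain ⟨k, hk⟩ := hx e
    obtain ⟨l, hl⟩ := hy e
    exact ⟨k + l, by simp [hk, hl]⟩
  neg_mem' := by
    intro x hx e
    obtain ⟨k, hk⟩ := hx e
    exact ⟨-k, by simp [hk]⟩

/-- The lattice of integer cuts `Γ = Row(M) ∩ ℤ^E`. -/
def integerCuts (M : Matrix ρ E ℝ) : AddSubgroup (EuclideanSpace ℝ E) :=
  (cutSpace M).toAddSubgroup ⊓ integerPoints E

/-- The Voronoi cell, in the subspace `W`, of the point `p` of the lattice `Λ`. -/
def voronoiCell (W : Submodule ℝ (EuclideanSpace ℝ E)) (Λ : AddSubgroup (EuclideanSpace ℝ E))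
    (p : EuclideanSpace ℝ E) : Set (EuclideanSpace ℝ E) :=
  {x | x ∈ W ∧ ∀ q ∈ Λ, ‖x - p‖ ≤ ‖x - q‖}

/-- The poset of nonempty faces of a convex polytope `P` (the subsets on which some linear
functional attains its maximum over `P`; the zero functional gives `P` itself), ordered by
inclusion. -/
abbrev FacePoset (P : Set (EuclideanSpace ℝ E)) : Type _ :=
  {F : Set (EuclideanSpace ℝ E) // F.Nonempty ∧ IsExposed ℝ P F}

/-- The face poset `FP^c` of the Voronoi cell at the origin of the lattice of integer cuts. -/
abbrev CutFacePoset (M : Matrix ρ E ℝ) : Type _ :=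
  FacePoset (voronoiCell (cutSpace M) (integerCuts M) 0)

open Classical in
/-- The matrix `M` with the columns in the ground set of the submatroid `N` reoriented by the
signs `D`. -/
def orient (M : Matrix ρ E ℝ) (N : Matroid E) (D : N.E → ℤˣ) : Matrix ρ E ℝ :=
  fun i e => if h : e ∈ N.E then (((D ⟨e, h⟩ : ℤˣ) : ℤ) : ℝ) * M i e else M i e

open Classical in
/-- The orientation `D` of the submatroid `N` is coherent acyclic: for every `e ∈ E(N)` there is
a nonnegative integer vector `z`, supported on `E(N)`, such that `e + z` is an integer cut, where
the columns of `M` in `E(N)` are oriented according to `D`. -/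
def IsCoherentAcyclic (M : Matrix ρ E ℝ) (N : Matroid E) (D : N.E → ℤˣ) : Prop :=
  ∀ e ∈ N.E, ∃ z : E → ℕ, (∀ f ∉ N.E, z f = 0) ∧
    EuclideanSpace.single e (1 : ℝ) + WithLp.toLp 2 (fun f => (z f : ℝ)) ∈
      integerCuts (orient M N D)

/-- An element of `CAC(𝓜)`: a submatroid of `𝓜` (a subset of the ground set with the induced
independent sets) with a coherent acyclic orientation. -/
structure CAC (𝓜 : Matroid E) (M : Matrix ρ E ℝ) where
  /-- the submatroid -/
  N : Matroid E
  isRestriction : N ≤r 𝓜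
  /-- the orientation -/
  D : N.E → ℤˣ
  coherentAcyclic : IsCoherentAcyclic M N D

/-- `(N, D) ≤ (N', D')` iff `N'` is a submatroid of `N` and `D'` is induced from `D`. -/
instance (𝓜 : Matroid E) (M : Matrix ρ E ℝ) : PartialOrder (CAC 𝓜 M) where
  le a b := ∃ h : b.N ≤r a.N, ∀ e : b.N.E, b.D e = a.D ⟨e, h.subset e.2⟩
  le_refl a := ⟨Matroid.IsRestriction.refl, fun _ => rfl⟩
  le_trans := by
    rintro a b c ⟨hab, h1⟩ ⟨hbc, h2⟩
    exact ⟨hbc.trans hab, fun e => (h2 e).trans (h1 _)⟩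
  le_antisymm := by
    rintro ⟨N, hN, D, hD⟩ ⟨N', hN', D', hD'⟩ ⟨h, h1⟩ ⟨h', h2⟩
    obtain rfl : N = N' := h'.antisymm h
    obtain rfl : D = D' := funext fun e => h2 e
    rfl

end Lattice

end RegularMatroid

end

/-! Both posets are the poset of sign vectors of W = Row(M), with the conformal order reversed.
Total unimodularity enters through one fact: every w in W is a positive combination of
{0,1,-1}-vectors of W that conform to w (`conformal_induction`). Such vectors are integer cuts with
squared norm equal to their ℓ¹ norm, and ℓ¹ norms add along conformal sums. Hence the Voronoi
inequalities 2⟪x,q⟫ ≤ ‖q‖² for integer cuts q are equivalent to 2⟪x,w⟫ ≤ ‖w‖₁ for all w in W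
(`mem_voronoiCell_iff`).

So each nonempty face is the locus 2⟪x,w⟫ = ‖w‖₁ for some w in W, and the face of w lies in the face
of v iff v conforms to w (`supportFace_subset_iff`). In turn, a pair (N, D) is coherent acyclic iff
D, extended by zero, is the sign vector of some w in W (`isCoherentAcyclic_iff`). -/

namespace RegularMatroid

open scoped RealInnerProductSpace

/-! ### Conformal vectors -/

section Conformal

variable {E : Type*}

/-- `v` conforms to `w` if every nonzero coordinate of `v` has the same sign as in `w`. -/
def Conforms (v w : E → ℝ) : Prop :=
  ∀ e, v e ≠ 0 → SignType.sign (v e) = SignType.sign (w e)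

theorem Conforms.ne_zero {v w : E → ℝ} (h : Conforms v w) {e : E} (he : v e ≠ 0) : w e ≠ 0 := by
  have := h e he
  rwa [← sign_ne_zero, ← this, sign_ne_zero]

theorem Conforms.trans {u v w : E → ℝ} (h : Conforms u v) (h' : Conforms v w) :
    Conforms u w := fun e he => (h e he).trans (h' e (h.ne_zero he))

theorem Conforms.mul_nonneg {v w : E → ℝ} (h : Conforms v w) (e : E) : 0 ≤ v e * w e := by
  by_cases he : v e = 0
  · simp [he]
  have h1 := h e he
  rcases lt_or_gt_of_ne he with hv | hv
  · rw [sign_neg hv, eq_comm, sign_eq_neg_one_iff] at h1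
    exact mul_nonneg_of_nonpos_of_nonpos hv.le h1.le
  · rw [sign_pos hv, eq_comm, sign_eq_one_iff] at h1
    positivity

theorem Conforms.mul_nonneg_of_conforms {u v w : E → ℝ} (hu : Conforms u w) (hv : Conforms v w)
    (e : E) : 0 ≤ u e * v e := by
  by_cases he : v e = 0
  · simp [he]
  have h1 := _root_.mul_nonneg (hu.mul_nonneg e) (hv.mul_nonneg e)
  have h2 : 0 < w e ^ 2 := by have := hv.ne_zero he; positivity
  have h3 : u e * w e * (v e * w e) = u e * v e * w e ^ 2 := by ring
  rw [h3] at h1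
  exact nonneg_of_mul_nonneg_left h1 h2

theorem conforms_of_mul_nonneg {v w : E → ℝ} (h : ∀ e, 0 ≤ v e * w e)
    (h0 : ∀ e, w e = 0 → v e = 0) : Conforms v w := by
  intro e he
  have hw : w e ≠ 0 := fun h => he (h0 e h)
  have h1 : 0 < v e * w e := lt_of_le_of_ne (h e) (mul_ne_zero he hw).symm
  rcases pos_and_pos_or_neg_and_neg_of_mul_pos h1 with ⟨a, b⟩ | ⟨a, b⟩
  · rw [sign_pos a, sign_pos b]
  · rw [sign_neg a, sign_neg b]

variable [Fintype E]

/-- Subtracting from `w` a suitable positive multiple of a vector `v` supported on the support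
of `w` gives a vector that conforms to `w` and has smaller support. -/
theorem exists_pos_conforms_sub {v w : E → ℝ} (hvw : ∀ e, w e = 0 → v e = 0)
    (hpos : ∃ e, 0 < v e * w e) :
    ∃ t : ℝ, 0 < t ∧ Conforms (w - t • v) w ∧ ∃ e, w e ≠ 0 ∧ (w - t • v) e = 0 := by
  classical
  -- The least ratio `w e / v e` over coordinates where the signs agree: the first one to reach zero
  -- is `b`, and none has yet crossed zero.
  obtain ⟨b, hb, hmin⟩ := (Finset.univ.filter fun e => 0 < v e * w e).exists_min_image
    (fun e => w e / v e) (by obtain ⟨e, he⟩ := hpos; exact ⟨e, by simpa using he⟩)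
  simp only [Finset.mem_filter, Finset.mem_univ, true_and] at hb hmin
  have hv : v b ≠ 0 := fun h => by simp [h] at hb
  have hw : w b ≠ 0 := fun h => by simp [h] at hb
  have ht : 0 < w b / v b := by
    have : w b / v b = v b * w b / (v b) ^ 2 := by field_simp
    rw [this]; positivity
  refine ⟨w b / v b, ht, conforms_of_mul_nonneg (fun e => ?_) (fun e he => ?_), b, hw, ?_⟩
  · simp only [Pi.sub_apply, Pi.smul_apply, smul_eq_mul]
    rcases lt_or_ge 0 (v e * w e) with h | h
    · have h1 := hmin e h
      have h2 : v e ≠ 0 := fun h' => by simp [h'] at h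
      have h3 : w e / v e * (v e * w e) = w e * w e := by field_simp
      have h4 := mul_le_mul_of_nonneg_right h1 h.le
      nlinarith
    · nlinarith [mul_nonneg ht.le (neg_nonneg.2 h), mul_self_nonneg (w e)]
  · simp [he, hvw e he]
  · simp [hv]

theorem ncard_support_lt {v w : E → ℝ} (h : Conforms v w) (h' : ∃ e, w e ≠ 0 ∧ v e = 0) :
    (Function.support v).ncard < (Function.support w).ncard := by
  obtain ⟨e, he, he'⟩ := h'
  exact Set.ncard_lt_ncard ⟨fun f hf => h.ne_zero hf, fun hs => hs (a := e) he he'⟩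

theorem Conforms.sum_abs_add_smul {u v w : E → ℝ} (hu : Conforms u w) (hv : Conforms v w)
    {t : ℝ} (ht : 0 < t) : ∑ e, |u e + t * v e| = ∑ e, |u e| + t * ∑ e, |v e| := by
  rw [Finset.mul_sum, ← Finset.sum_add_distrib]
  refine Finset.sum_congr rfl fun e _ => ?_
  have h : 0 ≤ u e * (t * v e) := by
    rw [mul_left_comm]
    exact _root_.mul_nonneg ht.le (hu.mul_nonneg_of_conforms hv e)
  rw [(abs_add_eq_add_abs_iff _ _).2 (mul_nonneg_iff.1 h), abs_mul, abs_of_pos ht]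

end Conformal

/-! ### Conformal decomposition in the row space -/

section TotallyUnimodular

variable {E ρ : Type*}

theorem sum_mul_mem_cutSpace (M : Matrix ρ E ℝ) {k : ℕ} (f : Fin k → ρ) (c : Fin k → ℝ) :
    WithLp.toLp 2 (fun e => ∑ j, c j * M (f j) e) ∈ cutSpace M := by
  have : WithLp.toLp 2 (fun e => ∑ j, c j * M (f j) e)
      = ∑ j, c j • WithLp.toLp 2 (M.row (f j)) := by
    ext e; simp [Matrix.row]
  rw [this]
  exact Submodule.sum_mem _ fun j _ => Submodule.smul_mem _ _ (Submodule.subset_span ⟨_, rfl⟩)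

variable [Fintype E]

/-- A nonzero vector of the row space of a totally unimodular matrix has in its support the
support of a nonzero vector of the row space with entries in `{0, 1, -1}`. -/
theorem exists_sign_mem_cutSpace {M : Matrix ρ E ℝ} (hM : M.IsTotallyUnimodular)
    {w : EuclideanSpace ℝ E} (hw : w ∈ cutSpace M) (hw0 : w ≠ 0) :
    ∃ v ∈ cutSpace M, v ≠ 0 ∧ (∀ e, v e ∈ Set.range SignType.cast) ∧ ∀ e, w e = 0 → v e = 0 := by
  classical
  -- Take a nonsingular minor of maximal size among the columns where `w` vanishes. Bordering it by
  -- a fixed row `i` and a variable column `e` gives the required vector, as a function of `e`.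
  let p : ℕ → Prop := fun k => ∃ (f : Fin k → ρ) (g : Fin k → E),
    (∀ j, w (g j) = 0) ∧ (M.submatrix f g).det ≠ 0
  have hp0 : p 0 := ⟨Fin.elim0, Fin.elim0, fun j => j.elim0, by simp⟩
  have hbd : ∀ k, p k → k ≤ Fintype.card E := by
    rintro k ⟨f, g, -, hd⟩
    have hg : Function.Injective g := by
      intro a b hab
      by_contra hne
      exact hd (Matrix.det_zero_of_column_eq hne fun i => by simp [hab])
    simpa using Fintype.card_le_of_injective g hg
  obtain ⟨k, ⟨f, g, hg, hd⟩, hmax⟩ : ∃ k, p k ∧ ¬ p (k + 1) := by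
    refine ⟨_, Nat.findGreatest_spec (Nat.zero_le (Fintype.card E)) hp0, fun h => ?_⟩
    have := Nat.le_findGreatest (hbd _ h) h
    omega
  -- The cofactors along the bordering column do not depend on `e`, so the bordered minors form a
  -- combination of rows of `M`.
  let c : ρ → Fin (k + 1) → ℝ := fun i j =>
    (-1) ^ (j : ℕ) * (M.submatrix ((Fin.cons i f : Fin (k + 1) → ρ) ∘ j.succAbove) g).det
  have hexp : ∀ i e, (M.submatrix (Fin.cons i f : Fin (k + 1) → ρ) (Fin.cons e g)).det
      = ∑ j, c i j * M ((Fin.cons i f : Fin (k + 1) → ρ) j) e := by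
    intro i e
    rw [Matrix.det_succ_column_zero]
    refine Finset.sum_congr rfl fun j _ => ?_
    simp only [Matrix.submatrix_apply, Fin.cons_zero, c, Matrix.submatrix_submatrix]
    have : (Fin.cons e g : Fin (k + 1) → E) ∘ Fin.succ = g := by ext j; simp
    rw [this]; ring
  -- Otherwise the rows `f` span the row space; then `w`, vanishing on the columns `g` of a
  -- nonsingular minor, would be zero.
  have hne : ∃ i e, (M.submatrix (Fin.cons i f : Fin (k + 1) → ρ) (Fin.cons e g)).det ≠ 0 := by
    by_contra! hall
    have hrow : ∀ i, WithLp.toLp 2 (M.row i) ∈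
        Submodule.span ℝ (Set.range fun j : Fin k => WithLp.toLp 2 (M.row (f j))) := by
      intro i
      have h1 : (M.submatrix f g).det • WithLp.toLp 2 (M.row i)
          = ∑ j : Fin k, (-c i j.succ) • WithLp.toLp 2 (M.row (f j)) := by
        ext e
        have h2 := hall i e
        rw [hexp, Fin.sum_univ_succ] at h2
        have h3 : c i 0 = (M.submatrix f g).det := by
          have : (Fin.cons i f : Fin (k + 1) → ρ) ∘ Fin.succ = f := by ext j; simp
          simp [c, this]
        simp only [Fin.cons_zero, Fin.cons_succ, h3] at h2
        simp [Matrix.row]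
        linarith
      have h2 : WithLp.toLp 2 (M.row i) = ((M.submatrix f g).det)⁻¹ •
          ∑ j : Fin k, (-c i j.succ) • WithLp.toLp 2 (M.row (f j)) := by
        rw [← h1, smul_smul, inv_mul_cancel₀ hd, one_smul]
      rw [h2]
      exact Submodule.smul_mem _ _ (Submodule.sum_mem _ fun j _ =>
        Submodule.smul_mem _ _ (Submodule.subset_span ⟨j, rfl⟩))
    have hw' : w ∈ Submodule.span ℝ (Set.range fun j : Fin k => WithLp.toLp 2 (M.row (f j))) :=
      (Submodule.span_le.2 (by rintro _ ⟨i, rfl⟩; exact hrow i)) hw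
    obtain ⟨a, rfl⟩ := (Submodule.mem_span_range_iff_exists_fun ℝ).1 hw'
    have ha : Matrix.vecMul a (M.submatrix f g) = 0 := by
      ext j
      have := hg j
      simpa [Matrix.row, Matrix.vecMul, dotProduct] using this
    have := Matrix.eq_zero_of_vecMul_eq_zero hd ha
    exact hw0 (by simp [this])
  obtain ⟨i, e, hie⟩ := hne
  refine ⟨WithLp.toLp 2 fun e => (M.submatrix (Fin.cons i f : Fin (k + 1) → ρ)
    (Fin.cons e g)).det, ?_, fun h => hie ?_, fun e => ?_, fun e he => ?_⟩
  · simp only [hexp]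
    exact sum_mul_mem_cutSpace M _ _
  · exact congrArg (fun v : EuclideanSpace ℝ E => v e) h
  · exact (Matrix.isTotallyUnimodular_iff M).1 hM _ _ _
  -- A nonzero value here would be a larger nonsingular minor on zero columns of `w`.
  · by_contra h
    refine hmax ⟨_, _, fun j => ?_, h⟩
    refine Fin.cases ?_ (fun j => ?_) j
    · simpa using he
    · simpa using hg j

/-- A nonzero vector of the row space of a totally unimodular matrix has a nonzero vector of the
row space with entries in `{0, 1, -1}` conforming to it. -/
theorem exists_conforms_sign_mem_cutSpace {M : Matrix ρ E ℝ} (hM : M.IsTotallyUnimodular)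
    {w : EuclideanSpace ℝ E} (hw : w ∈ cutSpace M) (hw0 : w ≠ 0) :
    ∃ v ∈ cutSpace M, v ≠ 0 ∧ (∀ e, v e ∈ Set.range SignType.cast) ∧ Conforms v w := by
  induction hn : (Function.support w).ncard using Nat.strong_induction_on generalizing w with
  | _ n ih =>
  have key : ∃ v ∈ cutSpace M, (∀ e, v e ∈ Set.range SignType.cast) ∧
      (∀ e, w e = 0 → v e = 0) ∧ ∃ e, 0 < v e * w e := by
    obtain ⟨v, hv, hv0, hvs, hvw⟩ := exists_sign_mem_cutSpace hM hw hw0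
    obtain ⟨e, he⟩ : ∃ e, v e ≠ 0 := by
      by_contra! h
      exact hv0 (by ext e; simpa using h e)
    have hwe : w e ≠ 0 := fun h => he (hvw e h)
    rcases lt_or_gt_of_ne (mul_ne_zero he hwe) with h | h
    · refine ⟨-v, neg_mem hv, fun e => ?_, fun e he => by simp [hvw e he], e, by simpa using h⟩
      obtain ⟨s, hs⟩ := hvs e
      exact ⟨-s, by simp [← hs]⟩
    · exact ⟨v, hv, hvs, hvw, e, h⟩
  obtain ⟨v, hv, hvs, hvw, e, he⟩ := key
  obtain ⟨t, ht, hc, hlt⟩ := exists_pos_conforms_sub hvw ⟨e, he⟩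
  have hsub : w - t • v ∈ cutSpace M := sub_mem hw (Submodule.smul_mem _ _ hv)
  by_cases h0 : w - t • v = 0
  · refine ⟨v, hv, fun h => by simp [h] at he, hvs, conforms_of_mul_nonneg (fun e => ?_) hvw⟩
    rw [sub_eq_zero.1 h0]
    simp only [PiLp.smul_apply, smul_eq_mul]
    nlinarith [mul_nonneg ht.le (mul_self_nonneg (v e))]
  · obtain ⟨u, hu, hu0, hus, huc⟩ := ih _ (hn ▸ ncard_support_lt hc hlt) hsub h0 rfl
    exact ⟨u, hu, hu0, hus, huc.trans hc⟩

theorem mem_integerCuts_of_sign {M : Matrix ρ E ℝ} {v : EuclideanSpace ℝ E}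
    (hv : v ∈ cutSpace M) (hvs : ∀ e, v e ∈ Set.range SignType.cast) : v ∈ integerCuts M := by
  refine ⟨hv, fun e => ?_⟩
  obtain ⟨s, hs⟩ := hvs e
  exact ⟨(s : ℤ), by rw [← hs]; cases s <;> simp⟩

/-- Induction along a conformal decomposition into vectors with entries in `{0, 1, -1}`. -/
theorem conformal_induction {M : Matrix ρ E ℝ} (hM : M.IsTotallyUnimodular)
    {P : EuclideanSpace ℝ E → Prop} (zero : P 0)
    (add : ∀ u ∈ cutSpace M, ∀ v ∈ cutSpace M, (∀ e, v e ∈ Set.range SignType.cast) →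
      ∀ t : ℝ, 0 < t → Conforms u.ofLp (u + t • v).ofLp →
        Conforms v.ofLp (u + t • v).ofLp → P u → P (u + t • v))
    {w : EuclideanSpace ℝ E} (hw : w ∈ cutSpace M) : P w := by
  induction hn : (Function.support w).ncard using Nat.strong_induction_on generalizing w with
  | _ n ih =>
  by_cases hw0 : w = 0
  · exact hw0 ▸ zero
  obtain ⟨v, hv, hv0, hvs, hvc⟩ := exists_conforms_sign_mem_cutSpace hM hw hw0
  obtain ⟨e, he⟩ : ∃ e, v e ≠ 0 := by
    by_contra! h
    exact hv0 (by ext e; simpa using h e)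
  obtain ⟨t, ht, hc, hlt⟩ := exists_pos_conforms_sub (v := v.ofLp) (w := w.ofLp)
    (fun e he => by_contra fun h => hvc.ne_zero h he)
    ⟨e, lt_of_le_of_ne (hvc.mul_nonneg e) (mul_ne_zero he (hvc.ne_zero he)).symm⟩
  have hsub : w - t • v ∈ cutSpace M := sub_mem hw (Submodule.smul_mem _ _ hv)
  have hP := ih _ (hn ▸ ncard_support_lt hc hlt) hsub rfl
  have heq : w - t • v + t • v = w := sub_add_cancel _ _
  have := add (w - t • v) hsub v hv hvs t ht (by rw [heq]; exact hc) (by rw [heq]; exact hvc) hP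
  rwa [heq] at this

/-- Every coordinate in the support of a vector of the row space of a totally unimodular matrix
is in the support of a conforming integer vector. -/
theorem exists_conforms_integerCuts {M : Matrix ρ E ℝ} (hM : M.IsTotallyUnimodular)
    {w : EuclideanSpace ℝ E} (hw : w ∈ cutSpace M) {e : E} (he : w e ≠ 0) :
    ∃ v ∈ integerCuts M, Conforms v w ∧ v e ≠ 0 := by
  revert he
  refine conformal_induction hM (P := fun w => w e ≠ 0 → ∃ v ∈ integerCuts M,
    Conforms v w ∧ v e ≠ 0) (fun h => by simp at h) ?_ hw
  intro u hu v hv hvs t ht huc hvc ih he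
  by_cases h : v e = 0
  · obtain ⟨x, hx, hxc, hxe⟩ := ih (by simpa [h] using he)
    exact ⟨x, hx, hxc.trans huc, hxe⟩
  · exact ⟨v, mem_integerCuts_of_sign hv hvs, hvc, h⟩

end TotallyUnimodular

/-! ### Faces of the Voronoi cell -/

section Voronoi

variable {E ρ : Type*} [Fintype E]

theorem inner_eq_sum (x y : EuclideanSpace ℝ E) : ⟪x, y⟫ = ∑ e, x e * y e := by
  simp [PiLp.inner_apply, mul_comm]

theorem norm_le_norm_sub_iff (x q : EuclideanSpace ℝ E) :
    ‖x‖ ≤ ‖x - q‖ ↔ 2 * ⟪x, q⟫ ≤ ∑ e, q e ^ 2 := by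
  have h1 := norm_sub_sq_real x q
  have h2 : ‖q‖ ^ 2 = ∑ e, q e ^ 2 := by simp [EuclideanSpace.norm_sq_eq]
  rw [← sq_le_sq₀ (norm_nonneg _) (norm_nonneg _), h1, h2]
  constructor <;> intro h <;> linarith

/-- The Voronoi cell of the lattice of integer cuts is cut out by the inequalities of a zonotope. -/
theorem mem_voronoiCell_iff {M : Matrix ρ E ℝ} (hM : M.IsTotallyUnimodular)
    {x : EuclideanSpace ℝ E} :
    x ∈ voronoiCell (cutSpace M) (integerCuts M) 0 ↔
      x ∈ cutSpace M ∧ ∀ w ∈ cutSpace M, 2 * ⟪x, w⟫ ≤ ∑ e, |w e| := by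
  simp only [voronoiCell, Set.mem_ofPred_eq, sub_zero, norm_le_norm_sub_iff]
  refine and_congr_right fun hx => ⟨fun h w hw => ?_, fun h q hq => (h q hq.1).trans ?_⟩
  · refine conformal_induction hM (P := fun w => 2 * ⟪x, w⟫ ≤ ∑ e, |w e|) (by simp) ?_ hw
    intro u hu v hv hvs t ht huc hvc ih
    have h1 := h v (mem_integerCuts_of_sign hv hvs)
    have h2 : ∑ e, v e ^ 2 = ∑ e, |v e| := by
      refine Finset.sum_congr rfl fun e _ => ?_
      obtain ⟨s, hs⟩ := hvs e
      rw [← hs]; cases s <;> simp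
    have h3 := Conforms.sum_abs_add_smul huc hvc ht
    simp only [PiLp.add_apply, PiLp.smul_apply, smul_eq_mul]
    rw [h3, inner_add_right, inner_smul_right]
    rw [h2] at h1
    nlinarith [mul_le_mul_of_nonneg_left h1 ht.le]
  -- For integers, |k| ≤ k².
  · refine Finset.sum_le_sum fun e _ => ?_
    obtain ⟨k, hk⟩ := hq.2 e
    rw [hk, ← sq_abs]
    have : |(k : ℝ)| = ((|k| : ℤ) : ℝ) := by simp
    rw [this]
    exact_mod_cast Int.le_self_sq |k|

/-- The face of the Voronoi cell on which the functional `⟪w, ·⟫` is maximal. -/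
def supportFace (M : Matrix ρ E ℝ) (w : EuclideanSpace ℝ E) : Set (EuclideanSpace ℝ E) :=
  {x | x ∈ voronoiCell (cutSpace M) (integerCuts M) 0 ∧ 2 * ⟪x, w⟫ = ∑ e, |w e|}

/-- The orthogonal projection to the row space of half the sign vector of `w`. -/
noncomputable def faceCenter (M : Matrix ρ E ℝ) (w : EuclideanSpace ℝ E) : EuclideanSpace ℝ E :=
  (cutSpace M).starProjection (WithLp.toLp 2 fun e => (SignType.sign (w e) : ℝ) / 2)

theorem two_mul_inner_faceCenter (M : Matrix ρ E ℝ) (w : EuclideanSpace ℝ E)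
    {v : EuclideanSpace ℝ E} (hv : v ∈ cutSpace M) :
    2 * ⟪faceCenter M w, v⟫ = ∑ e, (SignType.sign (w e) : ℝ) * v e := by
  rw [faceCenter, Submodule.inner_starProjection_left_eq_right,
    Submodule.starProjection_eq_self_iff.2 hv, inner_eq_sum, Finset.mul_sum]
  exact Finset.sum_congr rfl fun e _ => by simp only; ring

theorem sign_mul_le_abs (s : SignType) (a : ℝ) : (s : ℝ) * a ≤ |a| := by
  cases s
  · simp
  · simpa using neg_le_abs a
  · simpa using le_abs_self a

/-- Pairing with a vector of the row space ignores the projection, leaving a signed sum bounded by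
the ℓ¹ norm, with equality at `w` itself. -/
theorem faceCenter_mem_supportFace {M : Matrix ρ E ℝ} (hM : M.IsTotallyUnimodular)
    {w : EuclideanSpace ℝ E} (hw : w ∈ cutSpace M) : faceCenter M w ∈ supportFace M w := by
  refine ⟨(mem_voronoiCell_iff hM).2 ⟨Submodule.starProjection_apply_mem _ _, fun v hv => ?_⟩, ?_⟩
  · rw [two_mul_inner_faceCenter M w hv]
    exact Finset.sum_le_sum fun e _ => sign_mul_le_abs _ _
  · rw [two_mul_inner_faceCenter M w hw]
    exact Finset.sum_congr rfl fun e _ => sign_mul_self _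

theorem supportFace_eq_setOf_isMax {M : Matrix ρ E ℝ} (hM : M.IsTotallyUnimodular)
    {w : EuclideanSpace ℝ E} (hw : w ∈ cutSpace M) :
    supportFace M w = {x ∈ voronoiCell (cutSpace M) (integerCuts M) 0 |
      ∀ y ∈ voronoiCell (cutSpace M) (integerCuts M) 0, ⟪w, y⟫ ≤ ⟪w, x⟫} := by
  ext x
  refine and_congr_right fun hx => ⟨fun h y hy => ?_, fun h => ?_⟩
  · have := ((mem_voronoiCell_iff hM).1 hy).2 w hw
    rw [real_inner_comm, real_inner_comm x]
    linarith
  · have h1 := faceCenter_mem_supportFace hM hw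
    have h2 := h _ h1.1
    rw [real_inner_comm, real_inner_comm x] at h2
    have := ((mem_voronoiCell_iff hM).1 hx).2 w hw
    linarith [h1.2]

theorem isExposed_supportFace {M : Matrix ρ E ℝ} (hM : M.IsTotallyUnimodular)
    {w : EuclideanSpace ℝ E} (hw : w ∈ cutSpace M) :
    IsExposed ℝ (voronoiCell (cutSpace M) (integerCuts M) 0) (supportFace M w) :=
  fun _ => ⟨innerSL ℝ w, supportFace_eq_setOf_isMax hM hw⟩

/-- The cell lies in the row space, so a functional matters only through the projection of its Riesz
vector. -/
theorem exists_eq_supportFace {M : Matrix ρ E ℝ} (hM : M.IsTotallyUnimodular)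
    {F : Set (EuclideanSpace ℝ E)} (hF : F.Nonempty)
    (hexp : IsExposed ℝ (voronoiCell (cutSpace M) (integerCuts M) 0) F) :
    ∃ w ∈ cutSpace M, F = supportFace M w := by
  obtain ⟨l, rfl⟩ := hexp hF
  let u := (InnerProductSpace.toDual ℝ (EuclideanSpace ℝ E)).symm l
  have hl : ∀ y ∈ cutSpace M, l y = ⟪(cutSpace M).starProjection u, y⟫ := fun y hy => by
    rw [Submodule.inner_starProjection_left_eq_right, Submodule.starProjection_eq_self_iff.2 hy,
      InnerProductSpace.toDual_symm_apply]
  refine ⟨_, Submodule.starProjection_apply_mem _ u, ?_⟩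
  rw [supportFace_eq_setOf_isMax hM (Submodule.starProjection_apply_mem _ u)]
  ext x
  refine and_congr_right fun hx => forall₂_congr fun y hy => ?_
  rw [hl y hy.1, hl x hx.1]

/-- The inclusion order of the faces is the reversed conformal order of the functionals. -/
theorem supportFace_subset_iff {M : Matrix ρ E ℝ} (hM : M.IsTotallyUnimodular)
    {v w : EuclideanSpace ℝ E} (hv : v ∈ cutSpace M) (hw : w ∈ cutSpace M) :
    supportFace M w ⊆ supportFace M v ↔ Conforms v w := by
  constructor
  -- Test the inclusion on the center of the face of `w`: equality of the sums forces sign(w e) · v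
  -- e = |v e| for each `e`.
  · intro h e he
    have h1 := (h (faceCenter_mem_supportFace hM hw)).2
    rw [two_mul_inner_faceCenter M w hv, Finset.sum_eq_sum_iff_of_le
      fun e _ => sign_mul_le_abs _ _] at h1
    have h2 := h1 e (Finset.mem_univ e)
    rw [← sign_mul_self (v e)] at h2
    have h3 := mul_right_cancel₀ he h2
    revert h3
    cases SignType.sign (w e) <;> cases SignType.sign (v e) <;> norm_num
  · rintro h x ⟨hx, hxw⟩
    refine ⟨hx, ?_⟩
    have hxv := ((mem_voronoiCell_iff hM).1 hx).2
    by_cases hv0 : v = 0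
    · simp [hv0]
    obtain ⟨e, he⟩ : ∃ e, v e ≠ 0 := by
      by_contra! h
      exact hv0 (by ext e; simpa using h e)
    -- Split `w` conformally as (w - t v) + t v. The bounds for the two summands add up to the bound
    -- for `w`, so tightness at `w` forces tightness at `v`.
    obtain ⟨t, ht, hc, -⟩ := exists_pos_conforms_sub (v := v.ofLp) (w := w.ofLp)
      (fun e he => by_contra fun h' => h.ne_zero h' he)
      ⟨e, lt_of_le_of_ne (h.mul_nonneg e) (mul_ne_zero he (h.ne_zero he)).symm⟩
    have h1 := hxv _ (sub_mem hw (Submodule.smul_mem _ t hv))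
    have h2 : ∑ e, |w e| = ∑ e, |(w - t • v) e| + t * ∑ e, |v e| := by
      rw [← Conforms.sum_abs_add_smul (u := (w - t • v).ofLp) hc h ht]
      simp
    rw [inner_sub_right, inner_smul_right] at h1
    have h3 := hxv v hv
    refine le_antisymm h3 ?_
    have : t * ∑ e, |v e| ≤ t * (2 * ⟪x, v⟫) := by linarith
    exact le_of_mul_le_mul_left this ht

end Voronoi

/-! ### Coherent acyclic orientations as sign vectors -/

section Orientation

variable {E ρ : Type*}

open Classical in
/-- The signs of an orientation, extended by `1`. -/
noncomputable def orientSign (N : Matroid E) (D : N.E → ℤˣ) (e : E) : ℤˣ :=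
  if h : e ∈ N.E then D ⟨e, h⟩ else 1

theorem orientSign_of_mem {N : Matroid E} (D : N.E → ℤˣ) {e : E} (h : e ∈ N.E) :
    orientSign N D e = D ⟨e, h⟩ := dif_pos h

theorem units_mul_self_cast (s : ℤˣ) : ((s : ℤ) : ℝ) * ((s : ℤ) : ℝ) = 1 := by
  rcases Int.units_eq_one_or s with rfl | rfl <;> simp

/-- Multiplication of the coordinates by the signs of an orientation. -/
noncomputable def reorient (N : Matroid E) (D : N.E → ℤˣ) : EuclideanSpace ℝ E →ₗ[ℝ] EuclideanSpace ℝ E where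
  toFun v := WithLp.toLp 2 fun e => ((orientSign N D e : ℤ) : ℝ) * v e
  map_add' u v := by ext e; simp [mul_add]
  map_smul' c v := by ext e; simp; ring

@[simp]
theorem reorient_apply (N : Matroid E) (D : N.E → ℤˣ) (v : EuclideanSpace ℝ E) (e : E) :
    reorient N D v e = ((orientSign N D e : ℤ) : ℝ) * v e := rfl

theorem reorient_reorient (N : Matroid E) (D : N.E → ℤˣ) (v : EuclideanSpace ℝ E) :
    reorient N D (reorient N D v) = v := by
  ext e
  rw [reorient_apply, reorient_apply, ← mul_assoc, units_mul_self_cast, one_mul]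

theorem cutSpace_orient (M : Matrix ρ E ℝ) (N : Matroid E) (D : N.E → ℤˣ) :
    cutSpace (orient M N D) = (cutSpace M).map (reorient N D) := by
  rw [cutSpace, cutSpace, Submodule.map_span, ← Set.range_comp]
  congr 2
  ext i e
  simp only [Function.comp_apply, reorient_apply, Matrix.row, orient, orientSign]
  split_ifs <;> simp

variable [Fintype E]

/-- An orientation is coherent acyclic iff it is the sign vector of a vector of the row space. -/
theorem isCoherentAcyclic_iff {M : Matrix ρ E ℝ} (hM : M.IsTotallyUnimodular) {N : Matroid E}
    {D : N.E → ℤˣ} : IsCoherentAcyclic M N D ↔ ∃ w ∈ cutSpace M,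
      (∀ e (h : e ∈ N.E), 0 < ((D ⟨e, h⟩ : ℤ) : ℝ) * w e) ∧ ∀ e ∉ N.E, w e = 0 := by
  classical
  constructor
  · intro h
    choose! z hz hmem using h
    let y : E → EuclideanSpace ℝ E := fun e =>
      EuclideanSpace.single e (1 : ℝ) + WithLp.toLp 2 (fun f => (z e f : ℝ))
    have hy : ∀ e f, y e f = (if f = e then 1 else 0) + (z e f : ℝ) := fun e f => by
      simp [y]
    -- Each summand is nonnegative and the one for `e` is positive at `e`, so the sum is positive on
    -- all of E(N).
    let w : EuclideanSpace ℝ E := ∑ e with e ∈ N.E, y e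
    have hw : ∀ f, w f = ∑ e with e ∈ N.E, y e f := fun f => by simp [w]
    refine ⟨reorient N D w, ?_, fun e h => ?_, fun f hf => ?_⟩
    · have : w ∈ cutSpace (orient M N D) :=
        Submodule.sum_mem _ fun e he => (hmem e (by simpa using he)).1
      rw [cutSpace_orient] at this
      obtain ⟨u, hu, hu'⟩ := this
      rw [← hu', reorient_reorient]
      exact hu
    · rw [reorient_apply, orientSign_of_mem D h, ← mul_assoc, units_mul_self_cast, one_mul, hw]
      refine Finset.sum_pos' (fun f _ => ?_) ⟨e, by simpa using h, ?_⟩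
      · rw [hy]; positivity
      · rw [hy, if_pos rfl]; positivity
    · rw [reorient_apply, hw, Finset.sum_eq_zero, mul_zero]
      intro e he
      have he' : e ∈ N.E := by simpa using he
      rw [hy, if_neg (fun h : f = e => hf (h ▸ he')), hz e he' f hf]
      simp
  · rintro ⟨w, hw, hpos, hzero⟩ e he
    have hwe : w e ≠ 0 := fun h => by simpa [h] using hpos e he
    obtain ⟨v, hv, hvc, hve⟩ := exists_conforms_integerCuts hM hw hwe
    choose k hk using hv.2
    have hv0 : ∀ f ∉ N.E, v f = 0 := fun f hf => by_contra fun h => hvc.ne_zero h (hzero f hf)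
    let m : E → ℤ := fun f => orientSign N D f * k f
    have hm : ∀ f, reorient N D v f = m f := fun f => by simp [m, hk]
    have hm0 : ∀ f, 0 ≤ m f := by
      intro f
      have : (0 : ℝ) ≤ m f := by
        rw [← hm, reorient_apply]
        by_cases hf : f ∈ N.E
        · rw [orientSign_of_mem D hf]
          have h1 := hpos f hf
          have h2 := hvc.mul_nonneg f
          have h3 : ((D ⟨f, hf⟩ : ℤ) : ℝ) * v f * (((D ⟨f, hf⟩ : ℤ) : ℝ) * w f) = v f * w f := by
            rw [mul_mul_mul_comm, units_mul_self_cast, one_mul]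
          rw [← h3] at h2
          exact nonneg_of_mul_nonneg_left h2 h1
        · simp [hv0 f hf]
      exact_mod_cast this
    have hme : m e ≠ 0 := by
      intro h
      have := hm e
      rw [h, reorient_apply] at this
      simp [hve] at this
    -- After reorientation the cut has nonnegative integer entries `m`, with m e ≥ 1; removing one
    -- unit at `e` leaves `z`, so no truncation occurs at `e`.
    refine ⟨fun f => if f = e then (m f - 1).toNat else (m f).toNat, fun f hf => ?_, ?_⟩
    · have h1 : m f = 0 := by
        have := hm f
        rw [reorient_apply, hv0 f hf, mul_zero] at this
        exact (Int.cast_eq_zero (α := ℝ)).1 this.symm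
      simp [h1]
    · have heq : EuclideanSpace.single e (1 : ℝ) + WithLp.toLp 2 (fun f =>
          ((if f = e then (m f - 1).toNat else (m f).toNat : ℕ) : ℝ)) = reorient N D v := by
        ext f
        rw [hm]
        have h1 := hm0 f
        by_cases hf : f = e
        · subst hf
          have h2 : 1 + ((m f - 1).toNat : ℤ) = m f := by omega
          simp only [PiLp.add_apply, PiLp.single_apply, if_true]
          exact_mod_cast h2
        · have h2 : ((m f).toNat : ℤ) = m f := Int.toNat_of_nonneg h1
          simp only [PiLp.add_apply, PiLp.single_apply, if_neg hf, zero_add]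
          exact_mod_cast h2
      rw [heq]
      refine ⟨?_, fun f => ⟨m f, hm f⟩⟩
      change _ ∈ cutSpace (orient M N D)
      rw [cutSpace_orient]
      exact Submodule.mem_map_of_mem hv.1

variable {𝓜 : Matroid E} {M : Matrix ρ E ℝ}

theorem exists_mem_cutSpace_of_CAC (hM : M.IsTotallyUnimodular) (a : CAC 𝓜 M) :
    ∃ w ∈ cutSpace M, (∀ e (h : e ∈ a.N.E), 0 < ((a.D ⟨e, h⟩ : ℤ) : ℝ) * w e) ∧
      ∀ e ∉ a.N.E, w e = 0 :=
  (isCoherentAcyclic_iff hM).1 a.coherentAcyclic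

theorem sign_eq_of_units_mul_pos {s : ℤˣ} {x : ℝ} (h : 0 < ((s : ℤ) : ℝ) * x) :
    SignType.sign x = SignType.sign (s : ℤ) := by
  rcases Int.units_eq_one_or s with rfl | rfl
  · have : 0 < x := by simpa using h
    simp [sign_pos this]
  · have : x < 0 := by simpa using h
    simp [sign_neg this]

theorem units_eq_of_sign_eq {s t : ℤˣ} (h : SignType.sign (s : ℤ) = SignType.sign (t : ℤ)) :
    s = t := by
  rcases Int.units_eq_one_or s with rfl | rfl <;> rcases Int.units_eq_one_or t with rfl | rfl <;>
    simp_all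

theorem conforms_iff_le {a b : CAC 𝓜 M} {v w : E → ℝ}
    (hw : ∀ e (h : e ∈ a.N.E), 0 < ((a.D ⟨e, h⟩ : ℤ) : ℝ) * w e) (hw0 : ∀ e ∉ a.N.E, w e = 0)
    (hv : ∀ e (h : e ∈ b.N.E), 0 < ((b.D ⟨e, h⟩ : ℤ) : ℝ) * v e) (hv0 : ∀ e ∉ b.N.E, v e = 0) :
    Conforms v w ↔ a ≤ b := by
  constructor
  · intro h
    have hv' : ∀ e ∈ b.N.E, v e ≠ 0 := fun e he h => by simpa [h] using hv e he
    have hsub : b.N.E ⊆ a.N.E := fun e he => by_contra fun he' =>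
      h.ne_zero (hv' e he) (hw0 e he')
    -- Both are restrictions of `𝓜`, so inclusion of ground sets suffices.
    have hres : b.N ≤r a.N := by
      obtain ⟨R, hR, h1⟩ := a.isRestriction
      obtain ⟨S, hS, h2⟩ := b.isRestriction
      have hSR : S ⊆ R := by rw [h1, h2] at hsub; exact hsub
      rw [h1, h2]
      exact Matroid.IsRestriction.of_subset 𝓜 hSR
    refine ⟨hres, fun e => units_eq_of_sign_eq ?_⟩
    rw [← sign_eq_of_units_mul_pos (hv e e.2), ← sign_eq_of_units_mul_pos (hw e (hsub e.2))]
    exact h e (hv' e e.2)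
  · rintro ⟨hres, hD⟩ e he
    have heb : e ∈ b.N.E := by_contra fun h => he (hv0 e h)
    rw [sign_eq_of_units_mul_pos (hv e heb), sign_eq_of_units_mul_pos (hw e (hres.subset heb)),
      hD ⟨e, heb⟩]

/-- Every vector of the row space is, up to positive factors, given by an element of `CAC`. -/
theorem exists_CAC_of_mem_cutSpace (hM : M.IsTotallyUnimodular) (hE : 𝓜.E = Set.univ)
    {w : EuclideanSpace ℝ E} (hw : w ∈ cutSpace M) :
    ∃ a : CAC 𝓜 M, (∀ e (h : e ∈ a.N.E), 0 < ((a.D ⟨e, h⟩ : ℤ) : ℝ) * w e) ∧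
      ∀ e ∉ a.N.E, w e = 0 := by
  let N : Matroid E := 𝓜 ↾ {e | w e ≠ 0}
  let D : N.E → ℤˣ := fun e => if 0 < w e then 1 else -1
  have hpos : ∀ e (h : e ∈ N.E), 0 < ((D ⟨e, h⟩ : ℤ) : ℝ) * w e := by
    intro e h
    have h' : w e ≠ 0 := h
    by_cases h0 : 0 < w e
    · simp [D, h0]
    · have : w e < 0 := lt_of_le_of_ne (not_lt.1 h0) h'
      simp [D, h0, this]
  have hzero : ∀ e ∉ N.E, w e = 0 := fun e h => by_contra h
  exact ⟨⟨N, Matroid.restrict_isRestriction 𝓜 _ (hE ▸ Set.subset_univ _), D,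
    (isCoherentAcyclic_iff hM).2 ⟨w, hw, hpos, hzero⟩⟩, hpos, hzero⟩

/-- A vector of the row space with a given sign vector. -/
noncomputable def CAC.vector (hM : M.IsTotallyUnimodular) (a : CAC 𝓜 M) : EuclideanSpace ℝ E :=
  (exists_mem_cutSpace_of_CAC hM a).choose

theorem CAC.vector_spec (hM : M.IsTotallyUnimodular) (a : CAC 𝓜 M) :
    a.vector hM ∈ cutSpace M ∧
      (∀ e (h : e ∈ a.N.E), 0 < ((a.D ⟨e, h⟩ : ℤ) : ℝ) * a.vector hM e) ∧
      ∀ e ∉ a.N.E, a.vector hM e = 0 :=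
  (exists_mem_cutSpace_of_CAC hM a).choose_spec

/-- The face of the Voronoi cell given by a coherent acyclic orientation of a submatroid. -/
noncomputable def CAC.toFace (hM : M.IsTotallyUnimodular) (a : CAC 𝓜 M) : CutFacePoset M :=
  ⟨supportFace M (a.vector hM), ⟨_, faceCenter_mem_supportFace hM (a.vector_spec hM).1⟩,
    isExposed_supportFace hM (a.vector_spec hM).1⟩

theorem CAC.toFace_le_iff (hM : M.IsTotallyUnimodular) {a b : CAC 𝓜 M} :
    a.toFace hM ≤ b.toFace hM ↔ a ≤ b := by
  obtain ⟨ha, ha1, ha2⟩ := a.vector_spec hM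
  obtain ⟨hb, hb1, hb2⟩ := b.vector_spec hM
  exact (supportFace_subset_iff hM hb ha).trans (conforms_iff_le ha1 ha2 hb1 hb2)

/-- The chosen vector of `a` need not be `w`, but the two have the same signs, hence the same face.
-/
theorem CAC.toFace_surjective (hM : M.IsTotallyUnimodular) (hE : 𝓜.E = Set.univ) :
    Function.Surjective (CAC.toFace hM : CAC 𝓜 M → CutFacePoset M) := by
  rintro ⟨F, hF, hexp⟩
  obtain ⟨w, hw, rfl⟩ := exists_eq_supportFace hM hF hexp
  obtain ⟨a, h1, h2⟩ := exists_CAC_of_mem_cutSpace hM hE hw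
  obtain ⟨ha, ha1, ha2⟩ := a.vector_spec hM
  refine ⟨a, Subtype.ext (Set.Subset.antisymm ?_ ?_)⟩
  · exact (supportFace_subset_iff hM hw ha).2 ((conforms_iff_le ha1 ha2 h1 h2).2 le_rfl)
  · exact (supportFace_subset_iff hM ha hw).2 ((conforms_iff_le h1 h2 ha1 ha2).2 le_rfl)

end Orientation

end RegularMatroid

theorem mainTheorem2 {E ρ : Type*} [Fintype E] [Finite ρ] (𝓜 : Matroid E)
    (hreg : RegularMatroid.IsRegular 𝓜)
    (M : Matrix ρ E ℝ) (hTU : M.IsTotallyUnimodular) (hM : RegularMatroid.Represents M 𝓜) :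
    Nonempty (RegularMatroid.CutFacePoset M ≃o RegularMatroid.CAC 𝓜 M) :=
  ⟨(RelIso.ofSurjective (OrderEmbedding.ofMapLEIff (RegularMatroid.CAC.toFace hTU)
    fun _ _ => RegularMatroid.CAC.toFace_le_iff hTU)
    (RegularMatroid.CAC.toFace_surjective hTU hM.1)).symm⟩
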